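/- Let $R$ be an associative ring with unit, not assumed commutative. Suppose the category of left $R$-modules is given a closed symmetric monoidal structure $(\wedge, K, a, \ell, c)$ whose product $\wedge$ is an additive functor in each of its two variables, and suppose that the unit $K$ is isomorphic to $R$ as an $R$-module. Then $R$ is commutative, and the symmetric monoidal category $(R\text{-mod}, \wedge, K, a, \ell, c)$ is additively symmetric monoidal equivalent to $R\text{-mod}$ with its usual tensor product $\otimes_R$; that is, there is an equivalence of categories from $R\text{-mod}$ to itself, given by additive functors $F$ and $G$ which are strong symmetric monoidal from $\wedge$ to $\otimes_R$ and from $\otimes_R$ to $\wedge$ respectively, such that the isomorphisms $\mathrm{id}\cong GF$ and $FG\cong\mathrm{id}$ are monoidal natural transformations. -/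

import Mathlib

open CategoryTheory MonoidalCategory

universe v u

/-- An additive closed symmetric monoidal structure on a preadditive category `C`: a monoidal
product with its unit and coherence isomorphisms, a symmetry, right adjoints of all the functors
`X ⊗ -`, and additivity of the product in each of the two variables. -/
structure AdditiveClosedSymmetricMonoidalStructure (C : Type u) [Category.{v} C]
    [Preadditive C] where
  /-- the product, the unit, the associator and the unitors -/
  monoidal : MonoidalCategory C
  /-- the commutativity isomorphism -/
  symmetric : SymmetricCategory C
  /-- the internal hom functors -/
  closed : MonoidalClosed C
  /-- the product is additive in both variables -/
  additive : MonoidalPreadditive C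

namespace AdditiveClosedSymmetricMonoidalStructure

/-- The unit object of the structure. -/
def unit {C : Type u} [Category.{v} C] [Preadditive C]
    (S : AdditiveClosedSymmetricMonoidalStructure C) : C :=
  letI := S.monoidal
  𝟙_ C

end AdditiveClosedSymmetricMonoidalStructure

/-- Two (preadditive) symmetric monoidal categories are additively symmetric monoidal equivalent:
there is an equivalence of categories, both of whose functors are additive and carry the structure
of a strong symmetric monoidal functor, in such a way that the unit and counit isomorphisms of the
equivalence are monoidal natural transformations. -/
def AdditivelySymmetricMonoidalEquivalent (C : Type u) [Category.{v} C] [Preadditive C]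
    [MonoidalCategory C] [SymmetricCategory C] (D : Type u) [Category.{v} D] [Preadditive D]
    [MonoidalCategory D] [SymmetricCategory D] : Prop :=
  ∃ (e : C ≌ D) (_ : e.functor.Braided) (_ : e.inverse.Braided),
    e.functor.Additive ∧ e.inverse.Additive ∧ e.IsMonoidal

namespace AdditiveClosedSymmetricMonoidalStructure

/-- Two structures `S` and `T` on `C` are equivalent if the symmetric monoidal categories
`(C, S)` and `(C, T)` are additively symmetric monoidal equivalent. -/
def Equivalent {C : Type u} [Category.{v} C] [Preadditive C]
    (S T : AdditiveClosedSymmetricMonoidalStructure C) : Prop :=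
  @AdditivelySymmetricMonoidalEquivalent C _ _ S.monoidal S.symmetric C _ _ T.monoidal T.symmetric

/-- The usual structure on the category of modules over a commutative ring `R`, given by the
tensor product over `R`. -/
noncomputable def tensorProduct (R : Type u) [CommRing R] :
    AdditiveClosedSymmetricMonoidalStructure (ModuleCat.{u} R) where
  monoidal := inferInstance
  symmetric := inferInstance
  closed := inferInstance
  additive := inferInstance

/-- The same structure for a ring `R` whose multiplication is known to be commutative. -/
noncomputable def tensorProductOfComm (R : Type u) [Ring R] (hR : ∀ a b : R, a * b = b * a) :
    AdditiveClosedSymmetricMonoidalStructure (ModuleCat.{u} R) :=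
  letI : CommRing R := { (inferInstance : Ring R) with mul_comm := hR }
  tensorProduct R

end AdditiveClosedSymmetricMonoidalStructure

/-! Endomorphisms of a monoidal unit commute, and those of `R` as a left module are right
multiplications, so `R` is commutative. Let Γ = Hom(K, -) (`unitPoints`). As K ≅ R, Γ is isomorphic
to the identity, hence an equivalence, and K separates, which makes the additive product R-linear.
Multiplying points then makes Γ lax symmetric monoidal. Closedness makes it strong: Hom(X ∧ Y, Z) ≅
Hom(Y, [X, Z]) ≅ Hom_R(ΓY, Hom(X, Z)) ≅ Hom_R(ΓY, Hom_R(ΓX, ΓZ)), so X ∧ Y represents bilinear maps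
(`isIso_unitPointsμ`). -/

namespace CategoryTheory

open Opposite MonoidalClosed

section Unit

variable {C : Type u} [Category.{v} C] [MonoidalCategory C]

/-- The endomorphisms of the unit object of a monoidal category commute. -/
theorem comp_comm_of_tensorUnit (f g : 𝟙_ C ⟶ 𝟙_ C) : f ≫ g = g ≫ f := by
  -- Eckmann–Hilton: `f` and `g` act on different factors of the squared unit, where both unitors
  -- agree.
  have hf : f ▷ 𝟙_ C = (ρ_ (𝟙_ C)).hom ≫ f ≫ (ρ_ (𝟙_ C)).inv := by simp
  have hg : 𝟙_ C ◁ g = (ρ_ (𝟙_ C)).hom ≫ g ≫ (ρ_ (𝟙_ C)).inv := by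
    rw [← unitors_equal, ← unitors_inv_equal]; simp
  have h := whisker_exchange f g
  rw [hf, hg] at h
  simpa using h.symm

end Unit

section MonoidalLinear

variable {R : Type*} [CommRing R] {C : Type u} [Category.{v} C] [Preadditive C] [Linear R C]
  [MonoidalCategory C] [MonoidalPreadditive C]

-- Tested on a point `x`, the interchange law moves the scalar to the squared unit; there the two
-- unitors agree, so it slides out.
omit [MonoidalPreadditive C] in
theorem smul_id_tensorUnit_whiskerRight
    (hC : ∀ ⦃X Y : C⦄ (f g : X ⟶ Y), (∀ x : 𝟙_ C ⟶ X, x ≫ f = x ≫ g) → f = g)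
    (r : R) (X : C) : (r • 𝟙 (𝟙_ C)) ▷ X = r • 𝟙 (𝟙_ C ⊗ X) := by
  have key : (λ_ X).inv ≫ (r • 𝟙 (𝟙_ C)) ▷ X ≫ (λ_ X).hom = r • 𝟙 X := by
    apply hC
    intro x
    rw [leftUnitor_inv_naturality_assoc, whisker_exchange_assoc, leftUnitor_naturality,
      unitors_equal, unitors_inv_equal, rightUnitor_naturality_assoc]
    simp
  rw [Iso.inv_comp_eq, ← Iso.eq_comp_inv] at key
  simpa using key

/-- If the unit object is a separator, then the product of a linear category is linear as soon as
it is additive. -/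
theorem MonoidalLinear.of_separating [BraidedCategory C]
    (hC : ∀ ⦃X Y : C⦄ (f g : X ⟶ Y), (∀ x : 𝟙_ C ⟶ X, x ≫ f = x ≫ g) → f = g) :
    MonoidalLinear R C := by
  -- A scalar on `X` comes from the unit factor, and the associator carries it over to `X ⊗ Y`.
  have h₁ (r : R) (X Y : C) : (r • 𝟙 X) ▷ Y = r • 𝟙 (X ⊗ Y) := by
    have e : r • 𝟙 X = (λ_ X).inv ≫ (r • 𝟙 (𝟙_ C)) ▷ X ≫ (λ_ X).hom := by
      rw [smul_id_tensorUnit_whiskerRight hC]; simp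
    have e' : ((r • 𝟙 (𝟙_ C)) ▷ X) ▷ Y = r • 𝟙 _ := by
      rw [whiskerRight_tensor_symm, smul_id_tensorUnit_whiskerRight hC]; simp
    rw [e, comp_whiskerRight, comp_whiskerRight, e']
    simp
  have h₂ (r : R) {X Y : C} (f : X ⟶ Y) (Z : C) : (r • f) ▷ Z = r • (f ▷ Z) := by
    have : r • f = (r • 𝟙 X) ≫ f := by simp
    rw [this, comp_whiskerRight, h₁]; simp
  refine ⟨fun X Y Z r f ↦ ?_, fun r X Y f Z ↦ h₂ r f Z⟩
  rw [← cancel_mono (β_ X Z).hom, BraidedCategory.braiding_naturality_right, h₂]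
  simp

end MonoidalLinear

section Points

variable (R : Type u) [CommRing R] (C : Type (u + 1)) [Category.{u} C] [Preadditive C]
  [Linear R C] [MonoidalCategory C]

/-- The functor sending an object to the module of morphisms from the unit object to it. -/
abbrev unitPoints : C ⥤ ModuleCat.{u} R := (linearCoyoneda R C).obj (op (𝟙_ C))

/-- The unit comparison of `unitPoints`. -/
noncomputable def unitPointsε : 𝟙_ (ModuleCat.{u} R) ⟶ (unitPoints R C).obj (𝟙_ C) :=
  ModuleCat.ofHom (LinearMap.toSpanSingleton R (𝟙_ C ⟶ 𝟙_ C) (𝟙 _))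

theorem isIso_unitPointsε (h : Function.Bijective fun r : R ↦ r • 𝟙 (𝟙_ C)) :
    IsIso (unitPointsε R C) :=
  (ConcreteCategory.isIso_iff_bijective _).2 h

variable {C} in
theorem unitPoints_hom_ext [(unitPoints R C).Faithful] {X Y : C} {f g : X ⟶ Y}
    (h : ∀ x : 𝟙_ C ⟶ X, x ≫ f = x ≫ g) : f = g :=
  (unitPoints R C).map_injective (ModuleCat.hom_ext (LinearMap.ext h))

variable [MonoidalPreadditive C] [MonoidalLinear R C]

variable {C} in
/-- The product of two points `𝟙_ C ⟶ X` and `𝟙_ C ⟶ Y`, as a bilinear map. -/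
noncomputable def unitPointsMul (X Y : C) : (𝟙_ C ⟶ X) →ₗ[R] (𝟙_ C ⟶ Y) →ₗ[R] (𝟙_ C ⟶ X ⊗ Y) :=
  LinearMap.mk₂ R (fun x y ↦ (λ_ (𝟙_ C)).inv ≫ (x ⊗ₘ y))
    (fun x x' y ↦ by simp [MonoidalPreadditive.add_tensor])
    (fun r x y ↦ by simp [MonoidalCategory.tensorHom_def])
    (fun x y y' ↦ by simp [MonoidalPreadditive.tensor_add])
    (fun r x y ↦ by simp [MonoidalCategory.tensorHom_def])

/-- The product of two points `𝟙_ C ⟶ X` and `𝟙_ C ⟶ Y`, as a map on the tensor product. -/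
noncomputable def unitPointsμ (X Y : C) :
    (unitPoints R C).obj X ⊗ (unitPoints R C).obj Y ⟶ (unitPoints R C).obj (X ⊗ Y) :=
  ModuleCat.ofHom (TensorProduct.lift (unitPointsMul R X Y))

/-- Points form a lax monoidal functor. -/
noncomputable instance : (unitPoints R C).LaxMonoidal where
  ε := unitPointsε R C
  μ := unitPointsμ R C
  μ_natural_left {X Y} f Z := by
    apply ModuleCat.MonoidalCategory.tensor_ext
    intro (x : 𝟙_ C ⟶ X) (z : 𝟙_ C ⟶ Z)
    change (λ_ (𝟙_ C)).inv ≫ ((x ≫ f) ⊗ₘ z) = ((λ_ (𝟙_ C)).inv ≫ (x ⊗ₘ z)) ≫ f ▷ Z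
    simp [MonoidalCategory.tensorHom_def, whisker_exchange]
  μ_natural_right {X Y} Z f := by
    apply ModuleCat.MonoidalCategory.tensor_ext
    intro (z : 𝟙_ C ⟶ Z) (x : 𝟙_ C ⟶ X)
    change (λ_ (𝟙_ C)).inv ≫ (z ⊗ₘ (x ≫ f)) = ((λ_ (𝟙_ C)).inv ≫ (z ⊗ₘ x)) ≫ Z ◁ f
    simp [MonoidalCategory.tensorHom_def]
  associativity X Y Z := by
    apply ModuleCat.MonoidalCategory.tensor_ext₃'
    intro (x : 𝟙_ C ⟶ X) (y : 𝟙_ C ⟶ Y) (z : 𝟙_ C ⟶ Z)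
    change ((λ_ (𝟙_ C)).inv ≫ (((λ_ (𝟙_ C)).inv ≫ (x ⊗ₘ y)) ⊗ₘ z)) ≫ (α_ X Y Z).hom =
      (λ_ (𝟙_ C)).inv ≫ (x ⊗ₘ ((λ_ (𝟙_ C)).inv ≫ (y ⊗ₘ z)))
    have h₁ : ((λ_ (𝟙_ C)).inv ≫ (x ⊗ₘ y)) ⊗ₘ z =
        (λ_ (𝟙_ C)).inv ▷ 𝟙_ C ≫ ((x ⊗ₘ y) ⊗ₘ z) := by
      rw [← tensorHom_id, tensorHom_comp_tensorHom, Category.id_comp]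
    have h₂ : x ⊗ₘ ((λ_ (𝟙_ C)).inv ≫ (y ⊗ₘ z)) =
        𝟙_ C ◁ (λ_ (𝟙_ C)).inv ≫ (x ⊗ₘ (y ⊗ₘ z)) := by
      rw [← id_tensorHom, tensorHom_comp_tensorHom, Category.id_comp]
    rw [h₁, h₂, Category.assoc, Category.assoc, associator_naturality]
    simp only [← Category.assoc]
    congr 1
    monoidal_coherence
  left_unitality X := by
    apply ModuleCat.MonoidalCategory.tensor_ext
    intro (r : R) (x : 𝟙_ C ⟶ X)
    change r • x = ((λ_ (𝟙_ C)).inv ≫ ((r • 𝟙 (𝟙_ C)) ⊗ₘ x)) ≫ (λ_ X).hom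
    simp [MonoidalCategory.tensorHom_def]
  right_unitality X := by
    apply ModuleCat.MonoidalCategory.tensor_ext
    intro (x : 𝟙_ C ⟶ X) (r : R)
    change r • x = ((λ_ (𝟙_ C)).inv ≫ (x ⊗ₘ (r • 𝟙 (𝟙_ C)))) ≫ (ρ_ X).hom
    rw [unitors_inv_equal]
    simp [MonoidalCategory.tensorHom_def]

/-- Points form a lax braided functor. -/
noncomputable instance [BraidedCategory C] : (unitPoints R C).LaxBraided where
  braided X Y := by
    apply ModuleCat.MonoidalCategory.tensor_ext
    intro (x : 𝟙_ C ⟶ X) (y : 𝟙_ C ⟶ Y)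
    change ((λ_ (𝟙_ C)).inv ≫ (x ⊗ₘ y)) ≫ (β_ X Y).hom = (λ_ (𝟙_ C)).inv ≫ (y ⊗ₘ x)
    rw [Category.assoc, BraidedCategory.braiding_naturality, ← Category.assoc]
    congr 1
    rw [← cancel_mono (ρ_ (𝟙_ C)).hom, Category.assoc, braiding_rightUnitor, unitors_inv_equal,
      unitors_equal]

section Closed

variable {C}

/-- Currying in a closed linear monoidal category is linear. -/
noncomputable def curryLinearEquiv (X Y Z : C) [Closed X] :
    (X ⊗ Y ⟶ Z) ≃ₗ[R] (Y ⟶ (ihom X).obj Z) :=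
  LinearEquiv.symm
    { toFun := uncurry
      invFun := curry
      left_inv := curry_uncurry
      right_inv := uncurry_curry
      map_add' := fun f g ↦ by simp [uncurry_eq]
      map_smul' := fun r f ↦ by simp [uncurry_eq] }

/-- The action of `unitPoints` on morphisms, if it is fully faithful. -/
noncomputable def unitPointsMapEquiv [(unitPoints R C).Full] [(unitPoints R C).Faithful]
    (X Y : C) : (X ⟶ Y) ≃ₗ[R] ((𝟙_ C ⟶ X) →ₗ[R] (𝟙_ C ⟶ Y)) :=
  LinearEquiv.ofBijective
    { toFun := fun f ↦ Linear.rightComp R (𝟙_ C) f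
      map_add' := fun f g ↦ by ext; simp
      map_smul' := fun r f ↦ by ext; simp }
    ⟨fun f g h ↦ (unitPoints R C).map_injective (ModuleCat.hom_ext h),
      fun g ↦ by
        obtain ⟨f, hf⟩ := (unitPoints R C).map_surjective
          (X := X) (Y := Y) (ModuleCat.ofHom g)
        exact ⟨f, congrArg ModuleCat.Hom.hom hf⟩⟩

omit [MonoidalPreadditive C] [MonoidalLinear R C] in
theorem comp_unitPointsMapEquiv_symm [(unitPoints R C).Full] [(unitPoints R C).Faithful]
    {X Y : C} (g : (𝟙_ C ⟶ X) →ₗ[R] (𝟙_ C ⟶ Y)) (x : 𝟙_ C ⟶ X) :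
    x ≫ (unitPointsMapEquiv R X Y).symm g = g x :=
  DFunLike.congr_fun ((unitPointsMapEquiv R X Y).apply_symm_apply g) x

-- Separates the two points, so that `y` can be absorbed by currying and `x` tested afterwards.
omit [Preadditive C] [Linear R C] [MonoidalPreadditive C] [MonoidalLinear R C] in
theorem leftUnitor_inv_comp_tensorHom {X Y : C} (x : 𝟙_ C ⟶ X) (y : 𝟙_ C ⟶ Y) :
    (λ_ (𝟙_ C)).inv ≫ (x ⊗ₘ y) = x ≫ (ρ_ X).inv ≫ X ◁ y := by
  rw [unitors_inv_equal, MonoidalCategory.tensorHom_def]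
  simp

theorem unitPointsμ_comp_map_injective [(unitPoints R C).Faithful] {X Y Z : C} [Closed X]
    {f g : X ⊗ Y ⟶ Z}
    (h : unitPointsμ R C X Y ≫ (unitPoints R C).map f =
      unitPointsμ R C X Y ≫ (unitPoints R C).map g) : f = g := by
  apply curry_injective
  apply unitPoints_hom_ext R
  intro y
  rw [← curry_natural_left, ← curry_natural_left]
  congr 1
  rw [← cancel_epi (ρ_ X).inv]
  apply unitPoints_hom_ext R
  intro x
  have := DFunLike.congr_fun (congrArg ModuleCat.Hom.hom h) (TensorProduct.tmul R x y)
  change ((λ_ (𝟙_ C)).inv ≫ (x ⊗ₘ y)) ≫ f = ((λ_ (𝟙_ C)).inv ≫ (x ⊗ₘ y)) ≫ g at this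
  simpa only [leftUnitor_inv_comp_tensorHom, Category.assoc] using this

/-- Fullness is used twice: each `y` gives a map `X ⟶ Z`, that is, a point of the internal hom; this
assignment is linear in `y`, so it comes from a map out of `Y`, which is uncurried. -/
theorem unitPointsμ_comp_map_surjective [(unitPoints R C).Full] [(unitPoints R C).Faithful]
    {X Y Z : C} [Closed X]
    (g : (unitPoints R C).obj X ⊗ (unitPoints R C).obj Y ⟶ (unitPoints R C).obj Z) :
    ∃ f : X ⊗ Y ⟶ Z, unitPointsμ R C X Y ≫ (unitPoints R C).map f = g := by
  let g' : (𝟙_ C ⟶ X) →ₗ[R] (𝟙_ C ⟶ Y) →ₗ[R] (𝟙_ C ⟶ Z) := TensorProduct.curry g.hom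
  let h : (𝟙_ C ⟶ Y) →ₗ[R] (𝟙_ C ⟶ (ihom X).obj Z) :=
    (curryLinearEquiv R X (𝟙_ C) Z).toLinearMap ∘ₗ Linear.leftComp R Z (ρ_ X).hom ∘ₗ
      (unitPointsMapEquiv R X Z).symm.toLinearMap ∘ₗ g'.flip
  refine ⟨uncurry ((unitPointsMapEquiv R _ _).symm h), ?_⟩
  apply ModuleCat.MonoidalCategory.tensor_ext
  intro (x : 𝟙_ C ⟶ X) (y : 𝟙_ C ⟶ Y)
  change ((λ_ (𝟙_ C)).inv ≫ (x ⊗ₘ y)) ≫ uncurry _ = g' x y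
  have hy : h y = curry ((ρ_ X).hom ≫ (unitPointsMapEquiv R X Z).symm (g'.flip y)) := rfl
  rw [leftUnitor_inv_comp_tensorHom, Category.assoc, Category.assoc, ← uncurry_natural_left,
    comp_unitPointsMapEquiv_symm, hy, uncurry_curry, Iso.inv_hom_id_assoc,
    comp_unitPointsMapEquiv_symm, LinearMap.flip_apply]

theorem isIso_unitPointsμ [(unitPoints R C).IsEquivalence] (X Y : C) [Closed X] :
    IsIso (unitPointsμ R C X Y) := by
  -- The universal property only has targets in the image of Γ; essential surjectivity puts the
  -- tensor product there and yields a left inverse.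
  let i := (unitPoints R C).objObjPreimageIso
    ((unitPoints R C).obj X ⊗ (unitPoints R C).obj Y)
  obtain ⟨f, hf⟩ := unitPointsμ_comp_map_surjective R i.inv
  have hl : unitPointsμ R C X Y ≫ (unitPoints R C).map f ≫ i.hom = 𝟙 _ := by
    rw [reassoc_of% hf, i.inv_hom_id]
  refine ⟨(unitPoints R C).map f ≫ i.hom, hl, ?_⟩
  -- The other composite is Γ of some `p` that fixes μ, so uniqueness forces `p = 𝟙 _`.
  obtain ⟨p, hp⟩ := (unitPoints R C).map_surjective
    (((unitPoints R C).map f ≫ i.hom) ≫ unitPointsμ R C X Y)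
  have : p = 𝟙 _ := unitPointsμ_comp_map_injective R (by
    rw [hp, ← Category.assoc, hl, Category.id_comp, Functor.map_id, Category.comp_id])
  rw [← hp, this, Functor.map_id]

end Closed

end Points

section Equivalence

variable {C D : Type*} [Category* C] [Category* D] [MonoidalCategory C] [MonoidalCategory D]
  [BraidedCategory C] [BraidedCategory D]

/-- The inverse of a braided equivalence is braided. -/
noncomputable abbrev Equivalence.inverseBraided (e : C ≌ D) [e.functor.Braided]
    [e.inverse.Monoidal] [e.IsMonoidal] : e.inverse.Braided where
  braided X Y := by
    apply e.functor.map_injective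
    -- After the counit, both sides reduce to the braiding of `D`, as the counit is monoidal.
    rw [← cancel_mono (e.counitIso.hom.app _)]
    have h₁ := e.functor_map_μ_inverse_comp_counitIso_hom_app_tensor X Y
    have h₂ := e.functor_map_μ_inverse_comp_counitIso_hom_app_tensor Y X
    have h₃ := e.counitIso.hom.naturality (β_ X Y).hom
    dsimp only [Functor.comp_map, Functor.id_map, Functor.id_obj, Functor.comp_obj] at h₁ h₂ h₃ ⊢
    simp only [Functor.map_comp, Category.assoc]
    rw [h₂, h₃, reassoc_of% h₁, BraidedCategory.braiding_naturality, Functor.map_braiding]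
    simp

end Equivalence

/-- If points define an equivalence to the modules over `R`, then it is a symmetric monoidal
equivalence. -/
theorem additivelySymmetricMonoidalEquivalent_of_unitPoints (R : Type u) [CommRing R]
    (C : Type (u + 1)) [Category.{u} C] [Preadditive C] [Linear R C] [MonoidalCategory C]
    [SymmetricCategory C] [MonoidalClosed C] [MonoidalPreadditive C]
    [(unitPoints R C).IsEquivalence] (h : Function.Bijective fun r : R ↦ r • 𝟙 (𝟙_ C)) :
    AdditivelySymmetricMonoidalEquivalent C (ModuleCat.{u} R) := by
  have : MonoidalLinear R C := .of_separating fun _ _ _ _ h ↦ unitPoints_hom_ext R h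
  have : IsIso (Functor.LaxMonoidal.ε (unitPoints R C)) := isIso_unitPointsε R C h
  have (X Y : C) : IsIso (Functor.LaxMonoidal.μ (unitPoints R C) X Y) := isIso_unitPointsμ R X Y
  let e := (unitPoints R C).asEquivalence
  let m : e.functor.Monoidal := Functor.Monoidal.ofLaxMonoidal (unitPoints R C)
  let b : e.functor.Braided :=
    { m with braided := Functor.LaxBraided.braided (F := unitPoints R C) }
  let := e.inverseMonoidal
  have hm : e.IsMonoidal := ⟨rfl, fun _ _ ↦ rfl⟩
  have : e.functor.Additive := inferInstanceAs (unitPoints R C).Additive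
  exact ⟨e, b, e.inverseBraided, this, e.inverse_additive, hm⟩

section ModuleCat

theorem mul_comm_of_tensorUnit_iso {R : Type u} [Ring R] [MonoidalCategory (ModuleCat.{u} R)]
    (i : 𝟙_ (ModuleCat.{u} R) ≅ ModuleCat.of R R) (a b : R) : a * b = b * a := by
  let m (r : R) : ModuleCat.of R R ⟶ ModuleCat.of R R :=
    ModuleCat.ofHom (LinearMap.toSpanSingleton R R r)
  have h := comp_comm_of_tensorUnit (i.hom ≫ m a ≫ i.inv) (i.hom ≫ m b ≫ i.inv)
  have h' : m a ≫ m b = m b ≫ m a := by simpa using h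
  simpa [m] using DFunLike.congr_fun (congrArg ModuleCat.Hom.hom h') (1 : R)

variable {R : Type u} [CommRing R]

/-- A module is the module of morphisms to it from a free module of rank one. -/
noncomputable def linearCoyonedaIsoId {K : ModuleCat.{u} R} (i : K ≅ ModuleCat.of R R) :
    (linearCoyoneda R (ModuleCat.{u} R)).obj (op K) ≅ 𝟭 _ :=
  (linearCoyoneda R (ModuleCat.{u} R)).mapIso i.symm.op ≪≫
    NatIso.ofComponents
      (fun M ↦ (ModuleCat.homLinearEquiv (S := R) ≪≫ₗ
        LinearMap.ringLmapEquivSelf R R M).toModuleIso)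
      (fun f ↦ by ext; rfl)

theorem bijective_smul_id_of_iso {K : ModuleCat.{u} R} (i : K ≅ ModuleCat.of R R) :
    Function.Bijective fun r : R ↦ r • 𝟙 K := by
  constructor
  · intro r s h
    have h' : i.inv ≫ (r • 𝟙 K) ≫ i.hom = i.inv ≫ (s • 𝟙 K) ≫ i.hom := by
      rw [show r • 𝟙 K = s • 𝟙 K from h]
    simpa using DFunLike.congr_fun (congrArg ModuleCat.Hom.hom h') (1 : R)
  · intro f
    refine ⟨i.hom (f (i.inv (1 : R))), ?_⟩
    rw [← cancel_mono i.hom, ← cancel_epi i.inv]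
    ext
    simp

end ModuleCat

end CategoryTheory

theorem AdditiveClosedSymmetricMonoidalStructure.equivalent_tensorProduct {R : Type u}
    [CommRing R] (S : AdditiveClosedSymmetricMonoidalStructure (ModuleCat.{u} R))
    (i : S.unit ≅ ModuleCat.of R R) :
    S.Equivalent (AdditiveClosedSymmetricMonoidalStructure.tensorProduct R) := by
  have : (@unitPoints R _ (ModuleCat.{u} R) _ _ _ S.monoidal).IsEquivalence :=
    Functor.isEquivalence_of_iso (linearCoyonedaIsoId i).symm
  exact @additivelySymmetricMonoidalEquivalent_of_unitPoints R _ (ModuleCat.{u} R) _ _ _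
    S.monoidal S.symmetric S.closed S.additive this (bijective_smul_id_of_iso i)

theorem proposition3p1 {R : Type u} [Ring R]
    (S : AdditiveClosedSymmetricMonoidalStructure (ModuleCat.{u} R))
    (hunit : Nonempty (S.unit ≅ ModuleCat.of R R)) :
    ∃ hR : ∀ a b : R, a * b = b * a,
      S.Equivalent (AdditiveClosedSymmetricMonoidalStructure.tensorProductOfComm R hR) := by
  obtain ⟨i⟩ := hunit
  have hR : ∀ a b : R, a * b = b * a := @mul_comm_of_tensorUnit_iso R _ S.monoidal i
  -- The underlying ring is unchanged, so `S` remains a structure on the same category.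
  let _ : CommRing R := { (inferInstance : Ring R) with mul_comm := hR }
  exact ⟨hR, S.equivalent_tensorProduct i⟩
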